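/- **Theorem 2.1.** Let $D=(d_1,\dots,d_n)$ be a sequence of positive integers, and let $\mathcal P(D)\subset\mathbb R^{\binom n2}$ be the polytope of all vectors $x=(\xi_{\{j,k\}})$, indexed by the unordered pairs $\{j,k\}$ with $1\le j\ne k\le n$, such that $0\le\xi_{\{j,k\}}\le1$ for all pairs and $\sum_{j\ne k}\xi_{\{j,k\}}=d_k$ for $k=1,\dots,n$. If $\mathcal P(D)$ is non-empty, the strictly concave function $$H(x)=\sum_{\{j,k\}}\Bigl(\xi_{\{j,k\}}\ln\frac1{\xi_{\{j,k\}}}+(1-\xi_{\{j,k\}})\ln\frac1{1-\xi_{\{j,k\}}}\Bigr)$$ (with $0\ln\frac10=0$) attains its maximum on $\mathcal P(D)$ at a unique point $z=(\zeta_{\{j,k\}})$. For $0<\delta\le 1/2$, call $D$ *$\delta$-tame* if $\mathcal P(D)$ is non-empty and $\delta\le\zeta_{\{j,k\}}\le1-\delta$ for all $j\ne k$. Let $0<\alpha<\beta<1$ be real numbers such that $\beta<2\sqrt\alpha-\alpha$ or, equivalently, $(\alpha+\beta)^2<4\alpha$. Then there exist a real number $\delta=\delta(\alpha,\beta)>0$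 and a positive integer $n_0=n_0(\alpha,\beta)$ such that every sequence $D=(d_1,\dots,d_n)$ of positive integers satisfying $$\alpha<\frac{d_i}{n-1}<\beta\qquad\text{for } i=1,\dots,n$$ is $\delta$-tame provided $n>n_0$. Moreover, the same conclusion holds with the explicit values $$n_0=\max\left\{\frac{\beta}{\alpha(1-\beta)},\ \frac{4(\beta-\alpha)}{4\alpha-(\alpha+\beta)^2}\right\}+1,\qquad \delta=\frac{\epsilon^6}{1+\epsilon^6},\qquad \epsilon=\min\left\{\alpha,\ \alpha-\frac{(\alpha+\beta)^2}{4}\right\},$$ where this $n_0$ is a real number, not necessarily an integer. -/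

import Mathlib

namespace DegreeSequence

/-- The polytope `P(D)` of the degree sequence `D`. A vector `(ξ_{j,k})` indexed by the unordered
pairs of distinct vertices is represented by the symmetric matrix with zero diagonal
that has `ξ_{j,k}` in the positions `(j, k)` and `(k, j)`. -/
def polytope {n : ℕ} (D : Fin n → ℕ) : Set (Matrix (Fin n) (Fin n) ℝ) :=
  {x | x.IsSymm ∧ (∀ k, x k k = 0) ∧ (∀ j k, 0 ≤ x j k ∧ x j k ≤ 1) ∧
    ∀ k, ∑ j with j ≠ k, x j k = (D k : ℝ)}

/-- The entropy `∑_{j,k} (ξ ln (1/ξ) + (1 - ξ) ln (1/(1 - ξ)))`, each unordered pair `{j, k}` of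
distinct vertices being counted once, with the convention `0 ln (1/0) = 0`. -/
noncomputable def entropy {n : ℕ} (x : Matrix (Fin n) (Fin n) ℝ) : ℝ :=
  ∑ j, ∑ k with j < k,
    (x j k * Real.log (1 / x j k) + (1 - x j k) * Real.log (1 / (1 - x j k)))

theorem entropy_eq_sum_binEntropy {n : ℕ} (x : Matrix (Fin n) (Fin n) ℝ) :
    entropy x = ∑ j, ∑ k with j < k, Real.binEntropy (x j k) := by
  simp [entropy, Real.binEntropy]

theorem continuous_entropy {n : ℕ} :
    Continuous (entropy : Matrix (Fin n) (Fin n) ℝ → ℝ) := by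
  have h : (entropy : Matrix (Fin n) (Fin n) ℝ → ℝ) =
      fun x => ∑ j, ∑ k with j < k, Real.binEntropy (x j k) := by
    funext x
    exact entropy_eq_sum_binEntropy x
  rw [h]
  refine continuous_finsetSum _ fun j _ => continuous_finsetSum _ fun k _ => ?_
  exact Real.binEntropy_continuous.comp (continuous_id.matrix_elem j k)

theorem isCompact_polytope {n : ℕ} (D : Fin n → ℕ) : IsCompact (polytope D) := by
  have hc : IsCompact (Set.univ.pi fun _ : Fin n => Set.univ.pi fun _ : Fin n =>
      Set.Icc (0 : ℝ) 1) :=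
    isCompact_univ_pi fun _ => isCompact_univ_pi fun _ => isCompact_Icc
  have he : ∀ j k : Fin n, Continuous fun x : Matrix (Fin n) (Fin n) ℝ => x j k :=
    fun j k => continuous_id.matrix_elem j k
  refine hc.of_isClosed_subset ?_ ?_
  · refine IsClosed.inter (isClosed_eq continuous_id.matrix_transpose continuous_id) ?_
    refine IsClosed.inter ?_ (IsClosed.inter ?_ ?_)
    · change IsClosed {x : Matrix (Fin n) (Fin n) ℝ | ∀ k, x k k = 0}
      simp only [Set.setOf_forall]
      exact isClosed_iInter fun k => isClosed_eq (he k k) continuous_const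
    · change IsClosed {x : Matrix (Fin n) (Fin n) ℝ | ∀ j k, 0 ≤ x j k ∧ x j k ≤ 1}
      simp only [Set.setOf_forall]
      exact isClosed_iInter fun j => isClosed_iInter fun k =>
        (isClosed_le continuous_const (he j k)).inter (isClosed_le (he j k) continuous_const)
    · change IsClosed {x : Matrix (Fin n) (Fin n) ℝ | ∀ k, ∑ j with j ≠ k, x j k = (D k : ℝ)}
      simp only [Set.setOf_forall]
      exact isClosed_iInter fun k => isClosed_eq
        (continuous_finsetSum _ fun j _ => he j k) continuous_const
  · intro x hx j _ k _
    exact hx.2.2.1 j k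

theorem convex_polytope {n : ℕ} (D : Fin n → ℕ) : Convex ℝ (polytope D) := by
  rintro x ⟨hx1, hx2, hx3, hx4⟩ y ⟨hy1, hy2, hy3, hy4⟩ a b ha hb hab
  refine ⟨(hx1.smul a).add (hy1.smul b), fun k => ?_, fun j k => ?_, fun k => ?_⟩
  · simp [hx2 k, hy2 k]
  · simp only [Matrix.add_apply, Matrix.smul_apply, smul_eq_mul]
    have h1 := hx3 j k
    have h2 := hy3 j k
    constructor
    · exact add_nonneg (mul_nonneg ha h1.1) (mul_nonneg hb h2.1)
    · nlinarith
  · simp only [Matrix.add_apply, Matrix.smul_apply, smul_eq_mul, Finset.sum_add_distrib,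
      ← Finset.mul_sum, hx4 k, hy4 k]
    rw [← add_mul, hab, one_mul]

theorem strictConcaveOn_entropy {n : ℕ} (D : Fin n → ℕ) :
    StrictConcaveOn ℝ (polytope D) entropy := by
  refine ⟨convex_polytope D, ?_⟩
  intro x hx y hy hxy a b ha hb hab
  have hc := Real.strictConcave_binEntropy
  have hle : ∀ j k, a * Real.binEntropy (x j k) + b * Real.binEntropy (y j k) ≤
      Real.binEntropy (a * x j k + b * y j k) := fun j k =>
    hc.concaveOn.2 (hx.2.2.1 j k) (hy.2.2.1 j k) ha.le hb.le hab
  obtain ⟨j, k, hjk, hne⟩ : ∃ j k, j < k ∧ x j k ≠ y j k := by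
    by_contra! hcon
    apply hxy
    ext j k
    rcases lt_trichotomy j k with h | h | h
    · exact hcon j k h
    · subst h
      rw [hx.2.1 j, hy.2.1 j]
    · rw [← hx.1.apply, ← hy.1.apply]
      exact hcon k j h
  simp only [entropy_eq_sum_binEntropy, smul_eq_mul, Finset.mul_sum, ← Finset.sum_add_distrib,
    Matrix.add_apply, Matrix.smul_apply]
  refine Finset.sum_lt_sum (fun i _ => Finset.sum_le_sum fun l _ => hle i l)
    ⟨j, Finset.mem_univ j, ?_⟩
  exact Finset.sum_lt_sum (fun l _ => hle j l)
    ⟨k, by simpa using hjk, hc.2 (hx.2.2.1 j k) (hy.2.2.1 j k) hne ha hb hab⟩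

/-- The entropy attains its maximum on a non-empty polytope `P(D)` at a unique point. -/
theorem existsUnique_isMaxOn_entropy {n : ℕ} {D : Fin n → ℕ} (h : (polytope D).Nonempty) :
    ∃! z, z ∈ polytope D ∧ IsMaxOn entropy (polytope D) z := by
  obtain ⟨z, hz, hmax⟩ :=
    (isCompact_polytope D).exists_isMaxOn h continuous_entropy.continuousOn
  refine ⟨z, ⟨hz, hmax⟩, fun w hw => ?_⟩
  exact (strictConcaveOn_entropy D).eq_of_isMaxOn hw.2 hmax hw.1 hz

/-- The maximum entropy matrix `z(D)`: the point of the non-empty polytope `P(D)` at which the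
entropy attains its maximum. -/
noncomputable def maxEntropyMatrix {n : ℕ} {D : Fin n → ℕ} (h : (polytope D).Nonempty) :
    Matrix (Fin n) (Fin n) ℝ :=
  (existsUnique_isMaxOn_entropy h).choose

theorem maxEntropyMatrix_mem {n : ℕ} {D : Fin n → ℕ} (h : (polytope D).Nonempty) :
    maxEntropyMatrix h ∈ polytope D :=
  (existsUnique_isMaxOn_entropy h).choose_spec.1.1

theorem isMaxOn_maxEntropyMatrix {n : ℕ} {D : Fin n → ℕ} (h : (polytope D).Nonempty) :
    IsMaxOn entropy (polytope D) (maxEntropyMatrix h) :=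
  (existsUnique_isMaxOn_entropy h).choose_spec.1.2

/-- `D` is `δ`-tame: `0 < δ ≤ 1/2`, the polytope `P(D)` is non-empty, and all off-diagonal entries
of the maximum entropy matrix lie between `δ` and `1 - δ`. -/
def IsTame {n : ℕ} (δ : ℝ) (D : Fin n → ℕ) : Prop :=
  0 < δ ∧ δ ≤ 1 / 2 ∧ ∃ h : (polytope D).Nonempty,
    ∀ j k : Fin n, j ≠ k → δ ≤ maxEntropyMatrix h j k ∧ maxEntropyMatrix h j k ≤ 1 - δ

end DegreeSequence

namespace DegreeSequence

open Finset

/-! By Lagrange duality, a point of the polytope with entries `sigmoid (l j + l k)` off the diagonal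
is the entropy maximizer (`isMaxOn_logisticMatrix`). Such potentials `l` are critical points of the
convex dual function. Minimize it over a box `[-R, R]ⁿ` with `exp (-R) = ε ^ 3`: if the minimizer is
interior, the degree equations hold and every entry lies between `sigmoid (-2R) = δ` and `1 - δ`.

Interiority (`box_variational_interior`) compares vertices `a`, `b` of largest and smallest
potential. Put `q = sigmoid (l a + l b)`. If `l` touches the boundary, each other vertex contributes
at most `q(1 - q) + ε ^ 3` to the degree of `b` weighted by `1 - q` plus the codegree of `a`
weighted by `q`. The degree bounds make this sum at least `(n - 1)(α(1 - q) + (1 - β)q)`. But `(α +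
β)² < 4α` says exactly that `q² - (α + β)q + α > 0` for all `q`, so the two estimates conflict for
large `n`. -/

theorem sum_ne_eq_two_mul_sum_lt {n : ℕ} {h : Fin n → Fin n → ℝ} (hs : ∀ j k, h j k = h k j) :
    ∑ k, ∑ j with j ≠ k, h j k = 2 * ∑ j, ∑ k with j < k, h j k := by
  have hsplit : ∀ k : Fin n, ∑ j with j ≠ k, h j k =
      ∑ j with j < k, h j k + ∑ j with k < j, h j k := fun k => by
    simp only [sum_filter, ← sum_add_distrib]
    refine sum_congr rfl fun j _ => ?_
    rcases lt_trichotomy j k with hjk | hjk | hjk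
    · simp [hjk, hjk.ne, hjk.not_gt]
    · simp [hjk]
    · simp [hjk, hjk.ne', hjk.not_gt]
  have hswap : ∑ k, ∑ j with j < k, h j k = ∑ j, ∑ k with j < k, h j k := by
    simp only [sum_filter]
    exact sum_comm
  have hsymm : ∑ k, ∑ j with k < j, h j k = ∑ j, ∑ k with j < k, h j k :=
    sum_congr rfl fun j _ => sum_congr rfl fun k _ => hs k j
  simp only [hsplit, sum_add_distrib]
  rw [hswap, hsymm, two_mul]

theorem sum_ne_mul_add {n : ℕ} {g : Fin n → Fin n → ℝ} (hg : ∀ j k, g j k = g k j)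
    (v : Fin n → ℝ) :
    ∑ k, ∑ j with j ≠ k, g j k * (v j + v k) = 2 * ∑ k, v k * ∑ j with j ≠ k, g j k := by
  have h : ∑ k, ∑ j with j ≠ k, g j k * v j = ∑ k, ∑ j with j ≠ k, g j k * v k := by
    simp only [sum_filter]
    rw [sum_comm]
    refine sum_congr rfl fun j _ => sum_congr rfl fun k _ => ?_
    rw [hg j k]
    simp only [ne_comm]
  simp only [mul_add, sum_add_distrib, h, mul_sum]
  rw [← two_mul, mul_sum]
  refine sum_congr rfl fun k _ => ?_
  rw [mul_sum]
  exact sum_congr rfl fun j _ => by ring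

/-! ### The dual problem on a box -/

theorem hasDerivAt_log_one_add_exp (x : ℝ) :
    HasDerivAt (fun y => Real.log (1 + Real.exp y)) (Real.sigmoid x) x := by
  have h := ((Real.hasDerivAt_exp x).const_add 1).log (by positivity)
  convert h using 1
  rw [Real.sigmoid_def, Real.exp_neg]
  have := Real.exp_pos x
  field_simp
  ring

/-- The variational inequality satisfied by a minimum of the dual of the entropy maximization
problem over a box. -/
theorem exists_box_variational {n : ℕ} (d : Fin n → ℝ) {R : ℝ} (hR : 0 ≤ R) :
    ∃ l : Fin n → ℝ, (∀ k, -R ≤ l k ∧ l k ≤ R) ∧ ∀ w : Fin n → ℝ, (∀ k, -R ≤ w k ∧ w k ≤ R) →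
      0 ≤ ∑ k, (w k - l k) * (∑ j with j ≠ k, Real.sigmoid (l j + l k) - d k) := by
  -- Twice the dual function: each unordered pair is counted twice, hence the factor 2 on the linear
  -- term.
  let F : (Fin n → ℝ) → ℝ := fun l =>
    ∑ k, ∑ j with j ≠ k, Real.log (1 + Real.exp (l j + l k)) - 2 * ∑ k, d k * l k
  have hF : Continuous F := by
    refine Continuous.sub (continuous_finsetSum _ fun k _ => continuous_finsetSum _ fun j _ => ?_)
      (by fun_prop)
    exact Continuous.log (by fun_prop) fun l => by positivity
  have hne : (Set.Icc (fun _ : Fin n => -R) fun _ => R).Nonempty :=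
    ⟨0, fun _ => by simpa using hR, fun _ => hR⟩
  obtain ⟨l, hl, hmin⟩ := isCompact_Icc.exists_isMinOn hne hF.continuousOn
  refine ⟨l, fun k => ⟨hl.1 k, hl.2 k⟩, fun w hw => ?_⟩
  have hw' : w ∈ Set.Icc (fun _ : Fin n => -R) fun _ => R := ⟨fun k => (hw k).1, fun k => (hw k).2⟩
  let v : Fin n → ℝ := fun k => w k - l k
  have hmin' : IsMinOn (fun t : ℝ => F fun k => l k + t * v k) (Set.Icc 0 1) 0 := by
    intro t ht
    have hmem : (fun k => l k + t * v k) ∈ Set.Icc (fun _ : Fin n => -R) fun _ => R := by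
      have := (convex_Icc (fun _ : Fin n => -R) fun _ => R).add_smul_sub_mem hl hw' ht
      exact this
    simpa using hmin hmem
  have hder : HasDerivAt (fun t : ℝ => F fun k => l k + t * v k)
      (∑ k, ∑ j with j ≠ k, Real.sigmoid (l j + l k) * (v j + v k) - 2 * ∑ k, d k * v k) 0 := by
    have hlin : ∀ k, HasDerivAt (fun t : ℝ => l k + t * v k) (v k) 0 := fun k => by
      simpa using ((hasDerivAt_id (0 : ℝ)).mul_const (v k)).const_add (l k)
    refine HasDerivAt.sub (HasDerivAt.fun_sum fun k _ => HasDerivAt.fun_sum fun j _ => ?_)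
      ((HasDerivAt.fun_sum fun k _ => (hlin k).const_mul (d k)).const_mul 2)
    refine HasDerivAt.comp (0 : ℝ) (h₂ := fun y => Real.log (1 + Real.exp y)) ?_
      ((hlin j).add (hlin k))
    simpa using hasDerivAt_log_one_add_exp (l j + l k)
  have hcone : (1 : ℝ) ∈ posTangentConeAt (Set.Icc (0 : ℝ) 1) 0 :=
    mem_posTangentConeAt_of_segment_subset (by rw [zero_add, segment_eq_Icc zero_le_one])
  have h0 := hmin'.localize.hasFDerivWithinAt_nonneg hder.hasFDerivAt.hasFDerivWithinAt hcone
  rw [sum_ne_mul_add (fun j k => by rw [add_comm])] at h0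
  have h1 : ∑ k, (w k - l k) * (∑ j with j ≠ k, Real.sigmoid (l j + l k) - d k) =
      ∑ k, v k * ∑ j with j ≠ k, Real.sigmoid (l j + l k) - ∑ k, d k * v k := by
    rw [← sum_sub_distrib]
    exact sum_congr rfl fun k _ => by simp only [v]; ring
  simp at h0
  linarith

/-! ### Optimality of logistic matrices -/

theorem mul_log_sub_log_le {x p : ℝ} (hx : 0 ≤ x) (hp : 0 < p) :
    x * (Real.log p - Real.log x) ≤ p - x := by
  rcases hx.eq_or_lt with rfl | hx
  · simpa using hp.le
  · rw [← Real.log_div hp.ne' hx.ne']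
    have h := Real.log_le_sub_one_of_pos (div_pos hp hx)
    calc x * Real.log (p / x) ≤ x * (p / x - 1) := by gcongr
      _ = p - x := by field_simp

theorem log_sigmoid_sub_log_one_sub (s : ℝ) :
    Real.log (Real.sigmoid s) - Real.log (1 - Real.sigmoid s) = s := by
  rw [← Real.sigmoid_neg, ← Real.sigmoid_mul_rexp_neg,
    Real.log_mul (Real.sigmoid_pos s).ne' (Real.exp_pos _).ne', Real.log_exp]
  ring

/-- A concave function lies below its tangent; the slope of the entropy at `sigmoid s` is `-s`. -/
theorem binEntropy_le_sigmoid {x : ℝ} (hx0 : 0 ≤ x) (hx1 : x ≤ 1) (s : ℝ) :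
    Real.binEntropy x ≤ Real.binEntropy (Real.sigmoid s) + (Real.sigmoid s - x) * s := by
  have h1 := mul_log_sub_log_le hx0 (Real.sigmoid_pos s)
  have h2 := mul_log_sub_log_le (sub_nonneg.2 hx1) (sub_pos.2 (Real.sigmoid_lt_one s))
  have h3 := log_sigmoid_sub_log_one_sub s
  rw [Real.binEntropy_eq_negMulLog_add_negMulLog_one_sub,
    Real.binEntropy_eq_negMulLog_add_negMulLog_one_sub]
  simp only [Real.negMulLog]
  have h4 : (Real.sigmoid s - x) * s = (Real.sigmoid s - x) *
    (Real.log (Real.sigmoid s) - Real.log (1 - Real.sigmoid s)) := by rw [h3]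
  rw [h4]
  linarith

/-- The symmetric matrix of logistic probabilities with potentials `l`. -/
noncomputable def logisticMatrix {n : ℕ} (l : Fin n → ℝ) : Matrix (Fin n) (Fin n) ℝ :=
  fun j k => if j = k then 0 else Real.sigmoid (l j + l k)

theorem logisticMatrix_of_ne {n : ℕ} (l : Fin n → ℝ) {j k : Fin n} (h : j ≠ k) :
    logisticMatrix l j k = Real.sigmoid (l j + l k) := if_neg h

theorem sum_logisticMatrix {n : ℕ} (l : Fin n → ℝ) (k : Fin n) :
    ∑ j with j ≠ k, logisticMatrix l j k = ∑ j with j ≠ k, Real.sigmoid (l j + l k) :=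
  sum_congr rfl fun _ hj => logisticMatrix_of_ne l (mem_filter.1 hj).2

theorem logisticMatrix_mem_polytope {n : ℕ} {D : Fin n → ℕ} {l : Fin n → ℝ}
    (hl : ∀ k, ∑ j with j ≠ k, Real.sigmoid (l j + l k) = D k) :
    logisticMatrix l ∈ polytope D := by
  refine ⟨?_, fun k => if_pos rfl, fun j k => ?_, fun k => by rw [sum_logisticMatrix, hl]⟩
  · ext j k
    simp only [Matrix.transpose_apply, logisticMatrix, eq_comm, add_comm]
  · unfold logisticMatrix
    split_ifs
    · simp
    · exact ⟨Real.sigmoid_nonneg _, Real.sigmoid_le_one _⟩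

theorem sum_lt_mul_add_of_mem_polytope {n : ℕ} {D : Fin n → ℕ} {x : Matrix (Fin n) (Fin n) ℝ}
    (hx : x ∈ polytope D) (l : Fin n → ℝ) :
    ∑ j, ∑ k with j < k, x j k * (l j + l k) = ∑ k, l k * D k := by
  have hs : ∀ j k, x j k = x k j := fun j k => hx.1.apply k j
  have h1 := sum_ne_eq_two_mul_sum_lt (h := fun j k => x j k * (l j + l k))
    fun j k => by rw [hs, add_comm]
  have h2 := sum_ne_mul_add hs l
  simp only [hx.2.2.2] at h2
  linarith

/-- Summed over pairs, the linear terms of the tangent bounds cancel, since on the polytope they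
depend only on `D`. -/
theorem isMaxOn_logisticMatrix {n : ℕ} {D : Fin n → ℕ} {l : Fin n → ℝ}
    (hl : logisticMatrix l ∈ polytope D) : IsMaxOn entropy (polytope D) (logisticMatrix l) := by
  intro x hx
  change entropy x ≤ entropy (logisticMatrix l)
  have h1 := sum_lt_mul_add_of_mem_polytope hx l
  have h2 := sum_lt_mul_add_of_mem_polytope hl l
  have h3 : entropy x ≤ ∑ j, ∑ k with j < k, (Real.binEntropy (logisticMatrix l j k) +
      (logisticMatrix l j k * (l j + l k) - x j k * (l j + l k))) := by
    rw [entropy_eq_sum_binEntropy]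
    refine sum_le_sum fun j _ => sum_le_sum fun k hk => ?_
    rw [logisticMatrix_of_ne l (mem_filter.1 hk).2.ne, ← sub_mul]
    exact binEntropy_le_sigmoid (hx.2.2.1 j k).1 (hx.2.2.1 j k).2 _
  simp only [sum_add_distrib, sum_sub_distrib, h1, h2, sub_self, add_zero] at h3
  rwa [entropy_eq_sum_binEntropy (logisticMatrix l)]

theorem maxEntropyMatrix_eq_logisticMatrix {n : ℕ} {D : Fin n → ℕ} {l : Fin n → ℝ}
    (hl : logisticMatrix l ∈ polytope D) (h : (polytope D).Nonempty) :
    maxEntropyMatrix h = logisticMatrix l :=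
  (existsUnique_isMaxOn_entropy h).unique ⟨maxEntropyMatrix_mem h, isMaxOn_maxEntropyMatrix h⟩
    ⟨hl, isMaxOn_logisticMatrix hl⟩

/-! ### Comparing the extreme vertices -/

theorem sigmoid_le_exp (x : ℝ) : Real.sigmoid x ≤ Real.exp x := by
  have h := Real.sigmoid_mul_rexp_neg (-x)
  rw [neg_neg] at h
  rw [← h]
  exact mul_le_of_le_one_left (Real.exp_pos x).le (Real.sigmoid_le_one _)

/-- Complete the square in `q`. The error `2(β - α)m + 1` is below `3(β - α)m < 3εm²`, while the
main term is `4εm²`. -/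
theorem quadratic_gap {α β ε m : ℝ} (hε : 4 * ε = 4 * α - (α + β) ^ 2) (hm : 1 ≤ m)
    (hε0 : 0 < ε) (hγ : β - α < ε * m) (hγm : 1 < (β - α) * m) (q : ℝ) :
    m * ε / 8 ≤ α * m * (1 - q) + (1 - β) * m * q - (m + 1) * (q * (1 - q)) := by
  have hid : 4 * (m + 1) * (α * m * (1 - q) + (1 - β) * m * q - (m + 1) * (q * (1 - q))) =
      (2 * (m + 1) * q - ((α + β) * m + 1)) ^ 2 + m ^ 2 * (4 * α - (α + β) ^ 2) -
        2 * ((β - α) * m) - 1 := by ring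
  rw [← hε] at hid
  have h1 : (β - α) * m < ε * m * m := by gcongr
  have h2 : ε * m * m ≤
      4 * (m + 1) * (α * m * (1 - q) + (1 - β) * m * q - (m + 1) * (q * (1 - q))) := by
    nlinarith [sq_nonneg (2 * (m + 1) * q - ((α + β) * m + 1))]
  have h3 : 4 * (m + 1) * (m * ε / 8) ≤ ε * m * m := by
    have hεm : 0 < ε * m := mul_pos hε0 (by linarith)
    nlinarith
  exact le_of_mul_le_mul_left (h3.trans h2) (by positivity)

theorem sigmoid_extreme_mul_exp (x y : ℝ) :
    Real.sigmoid (x + y) * Real.exp (-x) = (1 - Real.sigmoid (x + y)) * Real.exp y := by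
  rw [← Real.sigmoid_neg, ← Real.sigmoid_mul_rexp_neg, mul_assoc, ← Real.exp_add]
  congr 2
  ring

/-- The sign of `t` decides which summand is exponentially small; monotonicity bounds the other by
`q(1 - q)`. As `q exp (-x) = (1 - q) exp y`, smallness at either end suffices. -/
theorem sigmoid_extreme_le {x y t c : ℝ} (hx : t ≤ x) (hy : y ≤ t)
    (hc : Real.exp (-x) ≤ c ∨ Real.exp y ≤ c) :
    Real.sigmoid (t + y) * (1 - Real.sigmoid (x + y)) +
      (1 - Real.sigmoid (t + x)) * Real.sigmoid (x + y) ≤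
        Real.sigmoid (x + y) * (1 - Real.sigmoid (x + y)) + c := by
  set q := Real.sigmoid (x + y) with hq
  have hq0 : 0 ≤ q := Real.sigmoid_nonneg _
  have hq1 : 0 ≤ 1 - q := sub_nonneg.2 (Real.sigmoid_le_one _)
  have hid : q * Real.exp (-x) = (1 - q) * Real.exp y := sigmoid_extreme_mul_exp x y
  have hqc : q * Real.exp (-x) ≤ c := by
    rcases hc with h | h
    · nlinarith [Real.exp_pos (-x)]
    · nlinarith [Real.exp_pos y]
  have hu : Real.sigmoid (t + y) ≤ q := Real.sigmoid_le (by linarith)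
  have hv : 1 - Real.sigmoid (t + x) ≤ 1 - q := sub_le_sub_left (Real.sigmoid_le (by linarith)) 1
  rcases le_total 0 t with ht | ht
  · have h : 1 - Real.sigmoid (t + x) ≤ Real.exp (-x) := by
      rw [← Real.sigmoid_neg]
      exact (sigmoid_le_exp _).trans (Real.exp_le_exp.2 (by linarith))
    have h1 := mul_le_mul_of_nonneg_right hu hq1
    have h2 := mul_le_mul_of_nonneg_right h hq0
    linarith
  · have h : Real.sigmoid (t + y) ≤ Real.exp y :=
      (sigmoid_le_exp _).trans (Real.exp_le_exp.2 (by linarith))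
    have h1 := mul_le_mul_of_nonneg_right h hq1
    have h2 := mul_le_mul_of_nonneg_right hv hq0
    linarith

theorem sum_sigmoid_extreme_le {n : ℕ} {l : Fin n → ℝ} {a b : Fin n} {c : ℝ} (hab : a ≠ b)
    (ha : ∀ k, l k ≤ l a) (hb : ∀ k, l b ≤ l k)
    (hc : Real.exp (-l a) ≤ c ∨ Real.exp (l b) ≤ c) :
    (∑ j with j ≠ b, Real.sigmoid (l j + l b)) * (1 - Real.sigmoid (l a + l b)) +
      ((n : ℝ) - 1 - ∑ j with j ≠ a, Real.sigmoid (l j + l a)) * Real.sigmoid (l a + l b) ≤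
    ((n : ℝ) - 1 + 1) * (Real.sigmoid (l a + l b) * (1 - Real.sigmoid (l a + l b))) +
      ((n : ℝ) - 1 - 1) * c := by
  simp only [filter_ne']
  have hmem : b ∈ univ.erase a := mem_erase.2 ⟨hab.symm, mem_univ b⟩
  have hmem' : a ∈ univ.erase b := mem_erase.2 ⟨hab, mem_univ a⟩
  rw [← add_sum_erase _ _ hmem, ← add_sum_erase _ _ hmem', erase_right_comm, add_comm (l b) (l a)]
  set q := Real.sigmoid (l a + l b)
  have hcard : (((univ.erase a).erase b).card : ℝ) = (n : ℝ) - 1 - 1 := by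
    have h1 := card_erase_add_one hmem
    have h2 := card_erase_add_one (mem_univ a)
    rw [card_univ, Fintype.card_fin, ← h1] at h2
    have h3 : (((univ.erase a).erase b).card : ℝ) + 1 + 1 = n := by exact_mod_cast h2
    linarith
  have hsum := sum_le_card_nsmul ((univ.erase a).erase b) _ _ fun k _ =>
    sigmoid_extreme_le (ha k) (hb k) hc
  simp only [sum_add_distrib, ← sum_mul, sum_sub_distrib, sum_const, nsmul_eq_mul, hcard,
    mul_one] at hsum
  linarith

theorem sum_sigmoid_lt_sum_sigmoid {n : ℕ} (hn : 3 ≤ n) (l : Fin n → ℝ) {a b : Fin n}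
    (hab : l b < l a) :
    ∑ j with j ≠ b, Real.sigmoid (l j + l b) < ∑ j with j ≠ a, Real.sigmoid (l j + l a) := by
  have hne : a ≠ b := fun h => by simp [h] at hab
  simp only [filter_ne']
  have hmem : b ∈ univ.erase a := mem_erase.2 ⟨hne.symm, mem_univ b⟩
  have hmem' : a ∈ univ.erase b := mem_erase.2 ⟨hne, mem_univ a⟩
  rw [← add_sum_erase _ _ hmem, ← add_sum_erase _ _ hmem', erase_right_comm, add_comm (l b) (l a)]
  have hcard : ((univ.erase a).erase b).Nonempty := by
    rw [← card_pos, card_erase_of_mem hmem, card_erase_of_mem (mem_univ a), card_univ,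
      Fintype.card_fin]
    omega
  gcongr

/-! ### Interior minimizers and tameness -/

/-- Under the degree bounds, a solution of the variational inequality on the box `[-R, R]ⁿ` with
`exp (-R) = ε ^ 3` lies in the interior of the box. -/
theorem box_variational_interior {n : ℕ} {D : Fin n → ℕ} {α β ε R : ℝ} {l : Fin n → ℝ}
    (hα : 0 < α) (hβ : β < 1) (hε0 : 0 < ε) (hε : 4 * ε = 4 * α - (α + β) ^ 2)
    (hn : β - α < ε * ((n : ℝ) - 1)) (hn1 : 1 < n)
    (hD : ∀ k, α * ((n : ℝ) - 1) < D k ∧ (D k : ℝ) < β * ((n : ℝ) - 1))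
    (hR : 0 < R) (hRε : Real.exp (-R) = ε ^ 3) (hl : ∀ k, -R ≤ l k ∧ l k ≤ R)
    (hup : ∀ k, -R < l k → ∑ j with j ≠ k, Real.sigmoid (l j + l k) ≤ D k)
    (hlow : ∀ k, l k < R → (D k : ℝ) ≤ ∑ j with j ≠ k, Real.sigmoid (l j + l k)) (i : Fin n) :
    -R < l i ∧ l i < R := by
  by_contra hcon
  have : Nonempty (Fin n) := ⟨i⟩
  obtain ⟨a, ha⟩ := Finite.exists_max l
  obtain ⟨b, hb⟩ := Finite.exists_min l
  have hbd : l a = R ∨ l b = -R := by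
    by_contra! h
    exact hcon ⟨((hl b).1.lt_of_ne' h.2).trans_le (hb i), (ha i).trans_lt ((hl a).2.lt_of_ne h.1)⟩
  have hn1' : (1 : ℝ) < n := by exact_mod_cast hn1
  have hεα : ε ≤ α := by nlinarith [sq_nonneg (α + β)]
  have hεβ : ε ≤ 1 - β := by nlinarith [sq_nonneg (2 - α - β)]
  have hε4 : ε ≤ 1 / 4 := by nlinarith [sq_nonneg (α + β - 1), sq_nonneg (2 * α - 1), (hD i).1.trans (hD i).2]
  have hexp : Real.exp (-R + -R) < ε := by
    rw [Real.exp_add, hRε]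
    have h1 : ε ^ 3 ≤ ε := pow_le_of_le_one hε0.le (by linarith) (by norm_num)
    have h2 : ε ^ 3 < 1 := pow_lt_one₀ hε0.le (by linarith) (by norm_num)
    nlinarith [pow_pos hε0 3]
  -- Otherwise all potentials equal `R` or all equal `-R`, forcing degrees too extreme because `exp
  -- (-2R) < ε ≤ min α (1 - β)`.
  have hlt : l b < l a := by
    refine (hb a).lt_of_ne fun h => ?_
    have hconst : ∀ k, l k = l a := fun k => le_antisymm (ha k) (h ▸ hb k)
    have hS : ∑ j with j ≠ a, Real.sigmoid (l j + l a) =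
        ((n : ℝ) - 1) * Real.sigmoid (l a + l a) := by
      simp only [hconst, filter_ne', sum_const, nsmul_eq_mul, card_erase_of_mem (mem_univ a),
        card_univ, Fintype.card_fin, Nat.cast_sub hn1.le, Nat.cast_one]
    have hexp' := (sigmoid_le_exp (-R + -R)).trans_lt hexp
    have hu := hup a
    have hw := hlow a
    rw [hS] at hu hw
    rcases hbd with h' | h'
    · have h1 := hu (by linarith)
      rw [h', ← neg_neg (R + R), Real.sigmoid_neg, neg_add] at h1
      nlinarith [(hD a).2]
    · rw [h] at h'
      have h1 := hw (by linarith)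
      rw [h'] at h1
      nlinarith [(hD a).1]
  have hab : a ≠ b := fun h => by simp [h] at hlt
  have hua := hup a (by linarith [(hl b).1])
  have hlb := hlow b (by linarith [(hl a).2])
  have hD0 : 1 ≤ D i := by
    have h : (0 : ℝ) < D i := (mul_pos hα (by linarith)).trans (hD i).1
    exact_mod_cast h
  have hn3 : 3 ≤ n := by
    have h : (D i : ℝ) + 1 < n := by nlinarith [(hD i).2]
    have h' : D i + 1 < n := by exact_mod_cast h
    omega
  -- Integrality of the degrees turns the strict inequality into a gap of 1.
  have hdeg : (D b : ℝ) + 1 ≤ D a := by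
    have h := (hlb.trans_lt (sum_sigmoid_lt_sum_sigmoid hn3 l hlt)).trans_le hua
    have h' : D b < D a := by exact_mod_cast h
    exact_mod_cast h'
  have hγm : 1 < (β - α) * ((n : ℝ) - 1) := by linarith [(hD a).2, (hD b).1]
  have hc : Real.exp (-l a) ≤ ε ^ 3 ∨ Real.exp (l b) ≤ ε ^ 3 := by
    rw [← hRε]
    exact hbd.imp (fun h => by rw [h]) fun h => by rw [h]
  have h1 := sum_sigmoid_extreme_le hab ha hb hc
  set q := Real.sigmoid (l a + l b)
  have hq0 : 0 < q := Real.sigmoid_pos _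
  have hq1 : 0 < 1 - q := sub_pos.2 (Real.sigmoid_lt_one _)
  have h2 := quadratic_gap hε (by
    have : (3 : ℝ) ≤ n := by exact_mod_cast hn3
    linarith : (1 : ℝ) ≤ n - 1) hε0 hn hγm q
  have h3 := mul_le_mul_of_nonneg_right ((hD b).1.le.trans hlb) hq1.le
  have h4 := mul_le_mul_of_nonneg_right
    (sub_le_sub_left (hua.trans (hD a).2.le) ((n : ℝ) - 1)) hq0.le
  have h5 : ε ^ 3 ≤ ε / 16 := by nlinarith [mul_pos hε0 hε0]
  have h6 : ((n : ℝ) - 1 - 1) * ε ^ 3 ≤ ((n : ℝ) - 1) * (ε / 16) := by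
    have := pow_pos hε0 3
    nlinarith
  have h7 : 0 < ((n : ℝ) - 1) * ε := mul_pos (by linarith) hε0
  linarith

/-- The potentials of the maximum entropy matrix exist and are bounded. -/
theorem exists_potential {n : ℕ} {D : Fin n → ℕ} {α β ε R : ℝ}
    (hα : 0 < α) (hβ : β < 1) (hε0 : 0 < ε) (hε : 4 * ε = 4 * α - (α + β) ^ 2)
    (hn : β - α < ε * ((n : ℝ) - 1)) (hn1 : 1 < n)
    (hD : ∀ k, α * ((n : ℝ) - 1) < D k ∧ (D k : ℝ) < β * ((n : ℝ) - 1))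
    (hR : 0 < R) (hRε : Real.exp (-R) = ε ^ 3) :
    ∃ l : Fin n → ℝ, (∀ k, -R < l k ∧ l k < R) ∧
      ∀ k, ∑ j with j ≠ k, Real.sigmoid (l j + l k) = D k := by
  obtain ⟨l, hl, hvar⟩ := exists_box_variational (fun k => (D k : ℝ)) hR.le
  have hcoord : ∀ k t, -R ≤ t → t ≤ R →
      0 ≤ (t - l k) * (∑ j with j ≠ k, Real.sigmoid (l j + l k) - D k) := by
    intro k t ht1 ht2
    -- Moving one coordinate isolates the sign condition at `k`.
    have h := hvar (Function.update l k t) fun j => by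
      rcases eq_or_ne j k with rfl | hj
      · simp [ht1, ht2]
      · simpa [hj] using hl j
    rw [sum_eq_single k (fun j _ hj => by simp [hj]) (by simp)] at h
    simpa using h
  have hup : ∀ k, -R < l k → ∑ j with j ≠ k, Real.sigmoid (l j + l k) ≤ D k := fun k hk => by
    have := hcoord k (-R) le_rfl (by linarith)
    nlinarith
  have hlow : ∀ k, l k < R → (D k : ℝ) ≤ ∑ j with j ≠ k, Real.sigmoid (l j + l k) := fun k hk => by
    have := hcoord k R (by linarith) le_rfl
    nlinarith
  have hint := box_variational_interior hα hβ hε0 hε hn hn1 hD hR hRε hl hup hlow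
  exact ⟨l, hint, fun k => le_antisymm (hup k (hint k).1) (hlow k (hint k).2)⟩

theorem isTame_of_degree_bounds {n : ℕ} {D : Fin n → ℕ} {α β ε : ℝ}
    (hα : 0 < α) (hβ : β < 1) (hε0 : 0 < ε) (hε1 : ε < 1) (hε : 4 * ε = 4 * α - (α + β) ^ 2)
    (hn : β - α < ε * ((n : ℝ) - 1)) (hn1 : 1 < n)
    (hD : ∀ k, α * ((n : ℝ) - 1) < D k ∧ (D k : ℝ) < β * ((n : ℝ) - 1)) :
    IsTame (ε ^ 6 / (1 + ε ^ 6)) D := by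
  have h6 : 0 < ε ^ 6 := pow_pos hε0 6
  have h61 : ε ^ 6 ≤ 1 := pow_le_one₀ hε0.le hε1.le
  have h31 : ε ^ 3 < 1 := pow_lt_one₀ hε0.le hε1 (by norm_num)
  have h3 : 0 < ε ^ 3 := pow_pos hε0 3
  obtain ⟨l, hl, hsum⟩ := exists_potential (R := -Real.log (ε ^ 3)) hα hβ hε0 hε hn hn1 hD
    (neg_pos.2 (Real.log_neg h3 h31)) (by rw [neg_neg, Real.exp_log h3])
  have hmem := logisticMatrix_mem_polytope hsum
  have hδ : Real.sigmoid (Real.log (ε ^ 3) + Real.log (ε ^ 3)) = ε ^ 6 / (1 + ε ^ 6) := by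
    rw [Real.sigmoid_def, Real.exp_neg, Real.exp_add, Real.exp_log h3]
    field_simp
    ring
  have hne : (polytope D).Nonempty := ⟨_, hmem⟩
  refine ⟨by positivity, ?_, hne, fun j k hjk => ?_⟩
  · rw [div_le_div_iff₀ (by positivity) two_pos]
    linarith
  · rw [maxEntropyMatrix_eq_logisticMatrix hmem, logisticMatrix_of_ne l hjk, ← hδ]
    refine ⟨Real.sigmoid_le (by linarith [(hl j).1, (hl k).1]), ?_⟩
    rw [← Real.sigmoid_neg]
    exact Real.sigmoid_le (by linarith [(hl j).2, (hl k).2])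

end DegreeSequence

theorem theorem2p1 (α β : ℝ) (hα : 0 < α) (hαβ : α < β) (hβ : β < 1) :
    (β < 2 * Real.sqrt α - α ↔ (α + β) ^ 2 < 4 * α) ∧
    ((α + β) ^ 2 < 4 * α →
      (∃ δ : ℝ, 0 < δ ∧ ∃ n₀ : ℕ, 0 < n₀ ∧
        ∀ n : ℕ, n₀ < n → ∀ D : Fin n → ℕ,
          (∀ i, α < (D i : ℝ) / ((n : ℝ) - 1) ∧ (D i : ℝ) / ((n : ℝ) - 1) < β) →
          DegreeSequence.IsTame δ D) ∧
      ∀ ε δ n₀ : ℝ, ε = min α (α - (α + β) ^ 2 / 4) → δ = ε ^ 6 / (1 + ε ^ 6) →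
        n₀ = max (β / (α * (1 - β))) (4 * (β - α) / (4 * α - (α + β) ^ 2)) + 1 →
        0 < δ ∧ ∀ n : ℕ, n₀ < (n : ℝ) → ∀ D : Fin n → ℕ,
          (∀ i, α < (D i : ℝ) / ((n : ℝ) - 1) ∧ (D i : ℝ) / ((n : ℝ) - 1) < β) →
          DegreeSequence.IsTame δ D) := by
  refine ⟨?_, fun h => ?_⟩
  · have hs := Real.sq_sqrt hα.le
    have hs0 := Real.sqrt_nonneg α
    rw [show 4 * α = (2 * Real.sqrt α) ^ 2 by rw [mul_pow, hs]; norm_num,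
      sq_lt_sq₀ (by linarith) (by linarith), lt_sub_iff_add_lt, add_comm β α]
  have hexplicit : ∀ ε δ n₀ : ℝ, ε = min α (α - (α + β) ^ 2 / 4) → δ = ε ^ 6 / (1 + ε ^ 6) →
      n₀ = max (β / (α * (1 - β))) (4 * (β - α) / (4 * α - (α + β) ^ 2)) + 1 →
      0 < δ ∧ ∀ n : ℕ, n₀ < (n : ℝ) → ∀ D : Fin n → ℕ,
        (∀ i, α < (D i : ℝ) / ((n : ℝ) - 1) ∧ (D i : ℝ) / ((n : ℝ) - 1) < β) →
        DegreeSequence.IsTame δ D := by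
    rintro ε δ n₀ hε rfl rfl
    -- The second entry is always the smaller one.
    rw [min_eq_right (by linarith [sq_nonneg (α + β)])] at hε
    have hε0 : 0 < ε := by linarith
    have hε1 : ε < 1 := by linarith [sq_nonneg (α + β)]
    refine ⟨by positivity, fun n hn D hD => ?_⟩
    have hn' := lt_sub_iff_add_lt.2 hn
    -- The first term of the maximum serves only to give `n > 1`.
    have hm : 0 < (n : ℝ) - 1 :=
      (div_pos (by linarith) (mul_pos hα (by linarith))).trans ((le_max_left _ _).trans_lt hn')
    have hgap := (le_max_right _ _).trans_lt hn'
    rw [div_lt_iff₀ (by linarith)] at hgap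
    refine DegreeSequence.isTame_of_degree_bounds hα hβ hε0 hε1 (by linarith) ?_ ?_ fun k =>
      ⟨(lt_div_iff₀ hm).1 (hD k).1, (div_lt_iff₀ hm).1 (hD k).2⟩
    · rw [hε]
      linarith
    · exact_mod_cast sub_pos.1 hm
  obtain ⟨hδ, htame⟩ := hexplicit _ _ _ rfl rfl rfl
  refine ⟨⟨_, hδ, ⌈max (β / (α * (1 - β))) (4 * (β - α) / (4 * α - (α + β) ^ 2)) + 1⌉₊ + 1,
    Nat.succ_pos _, fun n hn => htame n ?_⟩, hexplicit⟩
  exact (Nat.le_ceil _).trans_lt (by exact_mod_cast (Nat.lt_succ_self _).trans hn)
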